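/- Let $g=\frac{\sqrt5-1}{2}$, $G=\frac{\sqrt5+1}{2}$, $\alpha\in[g,G]$ and $I_\alpha=[\alpha-2,\alpha)$. For $x\in I_\alpha\setminus\{0\}$ put $$d_\alpha(x)=2\Big\lfloor \frac{1}{2|x|}+\frac{1-\alpha}{2}\Big\rfloor+1,\qquad \varphi_\alpha(x)=\frac1{|x|}-d_\alpha(x),\qquad e(x)=\operatorname{sign}(x),$$ and $\varphi_\alpha(0)=0$. Let $$\Omega_\alpha=\big(I_\alpha\times[0,2-G)\big)\cup\Big(\Big(\frac{1-\alpha}{\alpha},\alpha\Big)\times(2-G,1]\Big)\cup\Big(\Big[\frac{\alpha-1}{2-\alpha},\alpha\Big)\times[1,G)\Big),$$ let $d\mu_\alpha=(1+xy)^{-2}\,dx\,dy$ on $\Omega_\alpha$ and $\tilde\mu_\alpha=(3\log G)^{-1}\mu_\alpha$, let $\Phi_\alpha(x,y)=\Big(\varphi_\alpha(x),\frac{1}{d_\alpha(x)+e(x)y}\Big)$ (for $x\ne0$, i.e. almost everywhere), let $\pi(x,y)=x$, and let $\nu_\alpha$ be the measure $\nu_\alpha(E)=\tilde\mu_\alpha(\{(x,y)\in\Omega_\alpha:x\in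 E\})$ on $I_\alpha$. Write $\mathcal B_C$ for the Borel $\sigma$-algebra of $C$. Then $(\Omega_\alpha,\mathcal B_{\Omega_\alpha},\tilde\mu_\alpha,\Phi_\alpha)$ is the natural extension of $(I_\alpha,\mathcal B_{I_\alpha},\nu_\alpha,\varphi_\alpha)$ in the sense of Rohlin. That is: $\tilde\mu_\alpha$ and $\nu_\alpha$ are probability measures, invariant under $\Phi_\alpha$ and $\varphi_\alpha$ respectively, where $\Phi_\alpha$ maps almost every point of $\Omega_\alpha$ into $\Omega_\alpha$; $\pi$ carries $\tilde\mu_\alpha$ to $\nu_\alpha$ and $\pi\circ\Phi_\alpha=\varphi_\alpha\circ\pi$ almost everywhere; and there is a Borel set $\Omega'\subseteq\Omega_\alpha$ of full measure which $\Phi_\alpha$ maps bijectively onto itself, measurably in both directions, such that $$\bigvee_{n=0}^\infty \Phi_\alpha^n\,\pi^{-1}(\mathcal B_{I_\alpha})=\mathcal B_{\Omega'}\quad\text{on }\Omega' .$$ -/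

import Mathlib

open MeasureTheory Set

noncomputable section

namespace OddCF

/-! ### Measure-preserving systems and natural extensions -/

/-- `(S, Borel sets of S, μ, T)` is a measure-preserving dynamical system on a probability space.
The measure `μ` lives on an ambient space `X` and is concentrated on `S`; the map `T` is given on
the ambient space, and maps almost every point of `S` to `S`. -/
structure IsSystem {X : Type*} [MeasurableSpace X]
    (S : Set X) (μ : Measure X) (T : X → X) : Prop where
  measurableSet : MeasurableSet S
  isProbabilityMeasure : IsProbabilityMeasure μ
  measure_compl : μ Sᶜ = 0
  ae_mapsTo : ∀ᵐ x ∂μ, T x ∈ S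
  measurePreserving : MeasurePreserving T μ μ

/-- `(S, μ, T)` is an extension of `(S₀, μ₀, T₀)` with factor map `π`. -/
structure IsExtension {X Y : Type*} [MeasurableSpace X] [MeasurableSpace Y]
    (S : Set X) (μ : Measure X) (T : X → X)
    (S₀ : Set Y) (μ₀ : Measure Y) (T₀ : Y → Y) (π : X → Y) : Prop where
  total : IsSystem S μ T
  base : IsSystem S₀ μ₀ T₀
  mapsTo : MapsTo π S S₀
  measurePreserving : MeasurePreserving π μ μ₀
  semiconj : ∀ᵐ z ∂μ, π (T z) = T₀ (π z)

/-- Given an invertible bimeasurable map `T` of `Z` and `π : Z → Y`, the `σ`-algebra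
`⋁_{n ≥ 0} Tⁿ π⁻¹(𝓑_Y)`. Since `T` is invertible, the family
`Tⁿ π⁻¹(𝓑_Y) = {Tⁿ(π⁻¹ E) : E ∈ 𝓑_Y}` is the pullback of `𝓑_Y` by `π ∘ T⁻ⁿ`. -/
abbrev joinForward {Z Y : Type*} [MeasurableSpace Z] [mY : MeasurableSpace Y]
    (T : Z ≃ᵐ Z) (π : Z → Y) : MeasurableSpace Z :=
  ⨆ n : ℕ, MeasurableSpace.comap (fun z => π (T.symm^[n] z)) mY

/-- `(S, μ, T)` is the natural extension, in the sense of Rohlin, of `(S₀, μ₀, T₀)`, with factor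
map `π`: it is an extension, and after discarding a null set, `T` is invertible (a bijection,
measurable in both directions) and `⋁_{n ≥ 0} Tⁿ π⁻¹(𝓑)` is the full Borel `σ`-algebra. -/
structure IsNaturalExtension {X Y : Type*} [MeasurableSpace X] [StandardBorelSpace X]
    [MeasurableSpace Y] [StandardBorelSpace Y]
    (S : Set X) (μ : Measure X) (T : X → X)
    (S₀ : Set Y) (μ₀ : Measure Y) (T₀ : Y → Y) (π : X → Y) : Prop where
  isExtension : IsExtension S μ T S₀ μ₀ T₀ π
  invertible_minimal :
    ∃ S' : Set X, S' ⊆ S ∧ MeasurableSet S' ∧ μ (S \ S') = 0 ∧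
      ∃ T' : S' ≃ᵐ S', (∀ z : S', (T' z : X) = T z) ∧
        joinForward T' (fun z : S' => π z) = (inferInstance : MeasurableSpace S')

/-! ### The odd continued fraction maps -/

/-- `g = (√5 - 1) / 2`. -/
def g : ℝ := (√5 - 1) / 2

/-- `G = (√5 + 1) / 2`. -/
def G : ℝ := (√5 + 1) / 2

/-- The interval `I_α = [α - 2, α)`. -/
def I (α : ℝ) : Set ℝ := Ico (α - 2) α

/-- The digit `d_α(x) = 2 [1 / (2|x|) + (1 - α) / 2] + 1`, for `x ≠ 0`. -/
def d (α x : ℝ) : ℝ := 2 * (⌊1 / (2 * |x|) + (1 - α) / 2⌋ : ℝ) + 1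

/-- The odd continued fraction map `φ_α`. -/
def phi (α x : ℝ) : ℝ := if x = 0 then 0 else 1 / |x| - d α x

/-- `Φ_α(x, y) = (φ_α(x), 1 / (d_α(x) + e(x) y))`, with `e(x)` the sign of `x`. The value on the
null set `x = 0` is irrelevant. -/
def Phi (α : ℝ) (z : ℝ × ℝ) : ℝ × ℝ :=
  (phi α z.1, 1 / (d α z.1 + Real.sign z.1 * z.2))

/-- The domain `Ω_α`. Here `(1 - α) / α = 1 / α - 1` is the image of the endpoint `α` and
`(α - 1) / (2 - α) = 1 / (2 - α) - 1` that of the endpoint `α - 2`, both computed with the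
digit `1`; for `α = g`, respectively `α = G`, they are the one-sided limits, which make the second,
respectively the third, rectangle empty. -/
def Omega (α : ℝ) : Set (ℝ × ℝ) :=
  I α ×ˢ Ico 0 (2 - G) ∪
  Ioo ((1 - α) / α) α ×ˢ Ioc (2 - G) 1 ∪
  Ico ((α - 1) / (2 - α)) α ×ˢ Ico 1 G

/-- The measure `dμ_α = (1 + x y)⁻² dx dy` on `Ω_α`. -/
def mu (α : ℝ) : Measure (ℝ × ℝ) :=
  (volume.restrict (Omega α)).withDensity
    (fun z => ENNReal.ofReal (1 / (1 + z.1 * z.2) ^ 2))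

/-- The normalised measure `(3 log G)⁻¹ μ_α`. -/
def muTilde (α : ℝ) : Measure (ℝ × ℝ) :=
  ENNReal.ofReal (1 / (3 * Real.log G)) • mu α

/-- The measure `ν_α(E) = (3 log G)⁻¹ μ_α {(x, y) ∈ Ω_α : x ∈ E}` on `I_α`. -/
def nu (α : ℝ) : Measure ℝ := (muTilde α).map Prod.fst

end OddCF

end

noncomputable section

namespace OddCF

/-! ### Invertible cores of measure-preserving maps -/

/-! Off countably many lines write `x = s/t` with sign `s` and digit `2k+1`; then `Φ_α` sends `(x,
y)` to `(t-(2k+1), 1/D)`, where `D = 2k+1+sy`. Invariance: these branches map into `Ω_α`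
(`mapsTo_branch`), have disjoint images (`branch_unique`), and their Jacobian matches the density
(`density_Phi`), so `Φ_α` preserves the measure of images of regular sets. As the mass is finite
(`mu_univ`), this forces invariance; surjectivity is never checked by hand. Invertibility: an
injective measure-preserving map of a standard Borel space is an automorphism of a conull set
(`exists_measurableEquiv_of_injOn`). Generation: a point is determined by the base points of its
backward orbit. `Φ_α` need not contract a fibre in one step, since `1/D` can approach `G > 1`, but
it contracts the weighted distance `gap` uniformly (`weight_branch`, `gap_Phi_le`). By
Lusin–Souslin, the injective Borel map `z ↦ (π T⁻ⁿ z)ₙ` then generates the whole Borel `σ`-algebra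
(`joinForward_eq_of_injective`). -/

theorem exists_measurable_leftInverse_on {X Y : Type*} [MeasurableSpace X] [StandardBorelSpace X]
    [Nonempty X] [MeasurableSpace Y] [MeasurableSpace.CountablySeparated Y]
    {T : X → Y} (hT : Measurable T) {D : Set X} (hD : MeasurableSet D) (hinj : InjOn T D) :
    ∃ U : Y → X, Measurable U ∧ ∀ x ∈ D, U (T x) = x := by
  have : StandardBorelSpace D := hD.standardBorel
  have he : MeasurableEmbedding (fun x : D => T x) :=
    (hT.comp measurable_subtype_coe).measurableEmbedding (injOn_iff_injective.1 hinj)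
  obtain ⟨U, hU, hUT⟩ := he.exists_measurable_extend (measurable_subtype_coe (p := (· ∈ D)))
    (fun _ => ‹Nonempty X›)
  exact ⟨U, hU, fun x hx => congrFun hUT ⟨x, hx⟩⟩

/-- A map which preserves the measure of the images of all subsets of a conull set preserves the
measure. -/
theorem measurePreserving_of_measure_image {X : Type*} [MeasurableSpace X] {μ : Measure X}
    [IsFiniteMeasure μ] {T : X → X} (hT : Measurable T) {D : Set X} (hD : MeasurableSet D)
    (hμD : μ Dᶜ = 0) (himg : ∀ B ⊆ D, MeasurableSet B → μ (T '' B) = μ B) :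
    MeasurePreserving T μ μ := by
  -- `T(T⁻¹A ∩ D) ⊆ A` gives `T_*μ ≤ μ`; equal finite total masses turn this into equality.
  refine ⟨hT, Measure.eq_of_le_of_measure_univ_eq ?_ ?_⟩
  · refine Measure.le_iff.2 fun A hA => ?_
    rw [Measure.map_apply hT hA, ← measure_inter_conull hμD,
      ← himg _ inter_subset_right ((hT hA).inter hD)]
    exact measure_mono (by rintro _ ⟨x, ⟨hx, -⟩, rfl⟩; exact hx)
  · rw [Measure.map_apply hT MeasurableSet.univ, preimage_univ]

/-- A measure-preserving map which is injective on a conull set restricts to a measurable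
automorphism of a smaller conull set. -/
theorem exists_measurableEquiv_of_injOn {X : Type*} [MeasurableSpace X] [StandardBorelSpace X]
    [Nonempty X] {μ : Measure X} [IsFiniteMeasure μ] {T : X → X} (hT : MeasurePreserving T μ μ)
    {D : Set X} (hD : MeasurableSet D) (hμD : μ Dᶜ = 0) (hinj : InjOn T D) :
    ∃ S ⊆ D, MeasurableSet S ∧ μ Sᶜ = 0 ∧ ∃ e : S ≃ᵐ S, ∀ z : S, (e z : X) = T z := by
  obtain ⟨U, hU, hUT⟩ := exists_measurable_leftInverse_on hT.measurable hD hinj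
  have hDae : ∀ᵐ x ∂μ, x ∈ D := hμD
  have hUTae : ∀ᵐ x ∂μ, U (T x) = x := hDae.mono hUT
  have hUμ : MeasurePreserving U μ μ := by
    refine ⟨hU, ?_⟩
    conv_lhs => rw [← hT.map_eq]
    rw [Measure.map_map hU hT.measurable,
      Measure.map_congr (f := U ∘ T) (g := id) hUTae, Measure.map_id]
  let := upgradeStandardBorel X
  have hmeas : MeasurableSet {x | T (U x) = x} :=
    measurableSet_eq_fun (hT.measurable.comp hU) measurable_id
  have hTUae : ∀ᵐ x ∂μ, T (U x) = x := by
    rw [← hT.map_eq, ae_map_iff hT.measurable.aemeasurable hmeas]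
    exact hUTae.mono fun x hx => by rw [hx]
  set W : Set X := {x | x ∈ D ∧ T (U x) = x} with hW
  have hWm : MeasurableSet W := hD.inter hmeas
  have hWae : ∀ᵐ x ∂μ, x ∈ W := hDae.and hTUae
  -- Points whose forward `T`-orbit and `U`-orbit both stay in `W`, where `U` inverts `T` on both
  -- sides. Both maps preserve `μ`, so this set is conull as well as invariant under both.
  set S : Set X := ⋂ n : ℕ, (T^[n] ⁻¹' W ∩ U^[n] ⁻¹' W) with hS
  have hmem : ∀ {z}, z ∈ S ↔ ∀ n : ℕ, T^[n] z ∈ W ∧ U^[n] z ∈ W := by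
    intro z; simp [hS]
  have hSW : S ⊆ W := fun z hz => (hmem.1 hz 0).1
  have hTS : ∀ z ∈ S, T z ∈ S := by
    refine fun z hz => hmem.2 fun n => ⟨?_, ?_⟩
    · rw [← Function.iterate_succ_apply]; exact (hmem.1 hz (n + 1)).1
    · cases n with
      | zero => exact (hmem.1 hz 1).1
      | succ n =>
        rw [Function.iterate_succ_apply, hUT z (hSW hz).1]
        exact (hmem.1 hz n).2
  have hUS : ∀ z ∈ S, U z ∈ S := by
    refine fun z hz => hmem.2 fun n => ⟨?_, ?_⟩
    · cases n with
      | zero => exact (hmem.1 hz 1).2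
      | succ n =>
        rw [Function.iterate_succ_apply, (hSW hz).2]
        exact (hmem.1 hz n).1
    · rw [← Function.iterate_succ_apply]; exact (hmem.1 hz (n + 1)).2
  refine ⟨S, fun z hz => (hSW hz).1, ?_, ?_, ?_⟩
  · exact MeasurableSet.iInter fun n =>
      ((hT.measurable.iterate n) hWm).inter ((hU.iterate n) hWm)
  · have : ∀ᵐ x ∂μ, x ∈ S := by
      have h : ∀ n : ℕ, ∀ᵐ x ∂μ, T^[n] x ∈ W ∧ U^[n] x ∈ W := fun n =>
        ((hT.iterate n).quasiMeasurePreserving.ae hWae).and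
          ((hUμ.iterate n).quasiMeasurePreserving.ae hWae)
      filter_upwards [ae_all_iff.2 h] with x hx using hmem.2 hx
    exact this
  · refine ⟨⟨⟨fun z => ⟨T z, hTS z z.2⟩, fun z => ⟨U z, hUS z z.2⟩, ?_, ?_⟩, ?_, ?_⟩, ?_⟩
    · exact fun z => Subtype.ext (hUT z (hSW z.2).1)
    · exact fun z => Subtype.ext (hSW z.2).2
    · exact (hT.measurable.comp measurable_subtype_coe).subtype_mk
    · exact (hU.comp measurable_subtype_coe).subtype_mk
    · exact fun z => rfl

/-- If the sequence `(π (T⁻ⁿ z))` determines `z`, then `⋁ Tⁿ π⁻¹(𝓑)` is everything. -/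
theorem joinForward_eq_of_injective {Z Y : Type*} [mZ : MeasurableSpace Z] [StandardBorelSpace Z]
    [mY : MeasurableSpace Y] [StandardBorelSpace Y] (T : Z ≃ᵐ Z) {π : Z → Y} (hπ : Measurable π)
    (hinj : Function.Injective fun (z : Z) (n : ℕ) => π (T.symm^[n] z)) :
    joinForward T π = mZ := by
  have hm : Measurable fun (z : Z) (n : ℕ) => π (T.symm^[n] z) :=
    measurable_pi_lambda _ fun n => hπ.comp (T.symm.measurable.iterate n)
  have he := hm.measurableEmbedding hinj
  refine Eq.trans ?_ he.comap_eq
  rw [joinForward, MeasurableSpace.pi, MeasurableSpace.comap_iSup]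
  simp only [MeasurableSpace.comap_comp]
  rfl

/-! ### The digits -/

theorem G_sq : G ^ 2 = G + 1 := by
  have h : √(5 : ℝ) ^ 2 = 5 := Real.sq_sqrt (by norm_num)
  unfold G; nlinarith

theorem g_eq : g = G - 1 := by unfold g G; ring

theorem G_gt : 1.618 < G := by
  have h : (2.236 : ℝ) < √5 := Real.lt_sqrt_of_sq_lt (by norm_num)
  unfold G; linarith

theorem G_lt : G < 1.6181 := by
  have h : √(5 : ℝ) < 2.2362 := (Real.sqrt_lt' (by norm_num)).2 (by norm_num)
  unfold G; linarith

/-- This and `one_le_of_mem` are the bounds `α ≤ G` and `g ≤ α` in polynomial form. They say that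
the third and the second rectangle of `Ω_α` have nonnegative width. -/
theorem sq_le_of_mem {α : ℝ} (hα : α ∈ Icc g G) : α ^ 2 ≤ α + 1 := by
  have h1 := hα.1; have h2 := hα.2; have := G_sq; have := G_gt
  rw [g_eq] at h1
  nlinarith

theorem one_le_of_mem {α : ℝ} (hα : α ∈ Icc g G) : 1 ≤ α ^ 2 + α := by
  have h1 := hα.1; have := G_sq; have := G_gt
  rw [g_eq] at h1
  nlinarith

theorem gt_of_mem {α : ℝ} (hα : α ∈ Icc g G) : 0.618 < α := by
  have h1 := hα.1; have := G_gt
  rw [g_eq] at h1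
  linarith

theorem lt_of_mem {α : ℝ} (hα : α ∈ Icc g G) : α < 1.6181 := hα.2.trans_lt G_lt

/-- For `x ≠ 0` and `u = 1/(2|x|) + (1-α)/2`, the value is `2{u} + α - 2`, with `{u}` the fractional
part. -/
theorem phi_mem_I {α : ℝ} (hα : α ∈ Icc g G) (x : ℝ) : phi α x ∈ I α := by
  have h1 := gt_of_mem hα; have h2 := lt_of_mem hα
  unfold phi I d
  split_ifs with hx
  · constructor <;> linarith
  · have h3 := Int.floor_le (1 / (2 * |x|) + (1 - α) / 2)
    have h4 := Int.lt_floor_add_one (1 / (2 * |x|) + (1 - α) / 2)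
    have h5 : 1 / |x| = 2 * (1 / (2 * |x|)) := by
      have := abs_pos.2 hx
      field_simp
    rw [h5]
    constructor <;> linarith

theorem exists_digit {α : ℝ} (hα : α ∈ Icc g G) {x : ℝ} (hx : x ∈ I α) (hx0 : x ≠ 0) :
    ∃ k : ℕ, d α x = 2 * k + 1 := by
  have h1 := gt_of_mem hα; have h2 := lt_of_mem hα; have h3 := sq_le_of_mem hα
  have hpos := abs_pos.2 hx0
  have h : 0 ≤ ⌊1 / (2 * |x|) + (1 - α) / 2⌋ := by
    rw [Int.floor_nonneg]
    -- Only `α > 1` matters: `α(α-1) ≤ 1` handles `x > 0`, and `(2-α)(α-1) = 1/4 - (α-3/2)²` handles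
    -- `x < 0`.
    have : α - 1 ≤ 1 / |x| := by
      rw [le_div_iff₀ hpos]
      rcases le_or_gt α 1 with h | h
      · nlinarith
      · rcases abs_cases x with ⟨he, -⟩ | ⟨he, -⟩ <;> rw [he]
        · nlinarith [hx.2]
        · nlinarith [hx.1, sq_nonneg (2 * α - 3)]
    have h5 : 1 / |x| = 2 * (1 / (2 * |x|)) := by field_simp
    linarith
  obtain ⟨k, hk⟩ := Int.eq_ofNat_of_zero_le h
  exact ⟨k, by rw [d, hk]; simp⟩

theorem countable_phi_eq (α c : ℝ) : {x | phi α x = c}.Countable := by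
  have : {x | phi α x = c} ⊆ {0} ∪ (range (fun k : ℤ => 1 / (c + (2 * k + 1))) ∪
      range (fun k : ℤ => -(1 / (c + (2 * k + 1))))) := by
    intro x hx
    rcases eq_or_ne x 0 with rfl | hx0
    · simp
    right
    have h : phi α x = c := hx
    rw [phi, if_neg hx0, d] at h
    have habs : |x| = 1 / (c + (2 * (⌊1 / (2 * |x|) + (1 - α) / 2⌋ : ℝ) + 1)) := by
      rw [← h, sub_add_cancel, one_div_one_div]
    rcases abs_choice x with he | he
    · left; exact ⟨_, (habs.symm.trans he)⟩
    · right; exact ⟨_, by rw [neg_eq_iff_eq_neg]; exact habs.symm.trans he⟩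
  exact ((countable_singleton 0).union ((countable_range _).union (countable_range _))).mono this

/-! ### Regular points -/

/-- The fibre coordinates in the finitely many horizontal lines bounding the pieces of `Ω_α`. -/
def excLines : Set ℝ := {0, 1, 2 - G}

/-- Endpoints of cylinders and of pieces of `Ω_α`. -/
def excPoints (α : ℝ) : Set ℝ :=
  {0, α - 2, (α - 1) / (2 - α)} ∪ {x | phi α x = α - 2}

/-- The points of `Ω_α` outside countably many lines. -/
def regular (α : ℝ) : Set (ℝ × ℝ) :=
  Omega α \ (Prod.fst ⁻¹' excPoints α ∪ Prod.snd ⁻¹' excLines)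

theorem Omega_subset_I {α : ℝ} (hα : α ∈ Icc g G) {z : ℝ × ℝ} (hz : z ∈ Omega α) : z.1 ∈ I α := by
  have h1 := gt_of_mem hα; have h2 := lt_of_mem hα; have h3 := sq_le_of_mem hα
  rcases hz with (⟨hx, -⟩ | ⟨hx, -⟩) | ⟨hx, -⟩
  · exact hx
  · refine ⟨le_trans ?_ hx.1.le, hx.2⟩
    rw [le_div_iff₀ (by linarith)]; nlinarith
  · refine ⟨le_trans ?_ hx.1, hx.2⟩
    rw [le_div_iff₀ (by linarith)]; nlinarith [sq_nonneg (2 * α - 3)]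

/-- The conditions on `t = 1 / |x|`, the half-digit `k`, and `y` at a regular point `(x, y)` with
`x` of sign `s`. -/
structure IsBranch (α s t : ℝ) (k : ℕ) (y : ℝ) : Prop where
  t_pos : 0 < t
  gt : α - 2 < t - (2 * k + 1)
  lt : t - (2 * k + 1) < α
  -- From here the bounds on `x = s/t` are multiplied out to be linear in `t`: `x < α`, `x > α - 2`,
  -- and below, the left ends of the two upper rectangles.
  end_pos : s = 1 → 1 < α * t
  end_neg : s = -1 → 1 < (2 - α) * t
  y_pos : 0 < y
  y_lt : y < G
  y_ne_one : y ≠ 1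
  y_ne : y ≠ 2 - G
  mid : 2 - G < y → y < 1 → (1 - α) * t < s * α
  top : 1 < y → (α - 1) * t < s * (2 - α)

theorem exists_branch {α : ℝ} (hα : α ∈ Icc g G) {z : ℝ × ℝ} (hz : z ∈ regular α) :
    ∃ s t : ℝ, ∃ k : ℕ, (s = 1 ∨ s = -1) ∧ z.1 = s / t ∧ Real.sign z.1 = s ∧ d α z.1 = 2 * k + 1 ∧
      phi α z.1 = t - (2 * k + 1) ∧ IsBranch α s t k z.2 := by
  obtain ⟨x, y⟩ := z
  obtain ⟨hΩ, hexc⟩ := hz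
  simp only [excPoints, excLines, mem_union, mem_preimage, mem_insert_iff, mem_singleton_iff,
    mem_ofPred_eq, not_or] at hexc
  obtain ⟨⟨⟨hx0, hx1, hx2⟩, hx3⟩, hy0, hy1, hy2⟩ := hexc
  have hG1 := G_gt; have hG2 := G_lt
  have h1 := gt_of_mem hα; have h2 := lt_of_mem hα; have h3 := sq_le_of_mem hα
  have hΩ' : x ∈ I α ∧ 0 < y ∧ y < G ∧ (2 - G < y → y < 1 → (1 - α) / α < x) ∧
      (1 < y → (α - 1) / (2 - α) < x) := by
    have hI : x ∈ I α := Omega_subset_I hα hΩ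
    refine ⟨hI, ?_⟩
    rcases hΩ with (⟨-, hy⟩ | ⟨hx, hy⟩) | ⟨hx, hy⟩
    · have hy : 0 ≤ y ∧ y < 2 - G := hy
      exact ⟨lt_of_le_of_ne hy.1 (Ne.symm hy0), by linarith, fun h => by linarith,
        fun h => by linarith⟩
    · have hy : 2 - G < y ∧ y ≤ 1 := hy
      exact ⟨by linarith, by linarith, fun _ _ => hx.1, fun h => by linarith⟩
    · have hy : 1 ≤ y ∧ y < G := hy
      exact ⟨by linarith, by linarith, fun _ h => by linarith,
        fun _ => lt_of_le_of_ne hx.1 (Ne.symm hx2)⟩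
  obtain ⟨hI, hy, hyG, hmid, htop⟩ := hΩ'
  obtain ⟨k, hk⟩ := exists_digit hα hI hx0
  have hphi : phi α x = 1 / |x| - (2 * k + 1) := by rw [phi, if_neg hx0, hk]
  have hphiI := phi_mem_I hα x
  have hpos := abs_pos.2 hx0
  have hI1 : α - 2 < x := lt_of_le_of_ne hI.1 (Ne.symm hx1)
  have hI2 : x < α := hI.2
  have hlo : α - 2 < 1 / |x| - (2 * k + 1) := by
    rw [← hphi]; exact lt_of_le_of_ne hphiI.1 (Ne.symm hx3)
  have hhi : 1 / |x| - (2 * k + 1) < α := by rw [← hphi]; exact hphiI.2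
  have hα2 : 0 < 2 - α := by linarith
  have hα0 : 0 < α := by linarith
  rcases lt_or_gt_of_ne hx0 with hneg | hxpos
  · rw [abs_of_neg hneg] at *
    have ht : 0 < 1 / -x := one_div_pos.2 hpos
    refine ⟨-1, 1 / -x, k, Or.inr rfl, by field_simp, Real.sign_of_neg hneg, hk, hphi, ?_⟩
    refine ⟨ht, hlo, hhi, fun h => by norm_num at h, fun _ => ?_, hy, hyG, hy1, hy2, ?_, ?_⟩
    · rw [mul_one_div, lt_div_iff₀ hpos]; linarith
    · intro ha hb
      have := hmid ha hb
      rw [div_lt_iff₀ hα0] at this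
      rw [mul_one_div, div_lt_iff₀ hpos]; linarith
    · intro ha
      have := htop ha
      rw [div_lt_iff₀ hα2] at this
      rw [mul_one_div, div_lt_iff₀ hpos]; linarith
  · rw [abs_of_pos hxpos] at *
    have ht : 0 < 1 / x := one_div_pos.2 hpos
    refine ⟨1, 1 / x, k, Or.inl rfl, by field_simp, Real.sign_of_pos hxpos, hk, hphi, ?_⟩
    refine ⟨ht, hlo, hhi, fun _ => ?_, fun h => by norm_num at h, hy, hyG, hy1, hy2, ?_, ?_⟩
    · rw [mul_one_div, lt_div_iff₀ hpos]; linarith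
    · intro ha hb
      have := hmid ha hb
      rw [div_lt_iff₀ hα0] at this
      rw [mul_one_div, div_lt_iff₀ hpos]; linarith
    · intro ha
      have := htop ha
      rw [div_lt_iff₀ hα2] at this
      rw [mul_one_div, div_lt_iff₀ hpos]; linarith

/-! ### Images, contraction and disjointness of the branches -/

theorem IsBranch.lt_of_neg_zero {α t y : ℝ} (hα : α ∈ Icc g G) (h : IsBranch α (-1) t 0 y) :
    y < 2 - G := by
  have h1 := gt_of_mem hα; have h2 := lt_of_mem hα; have h3 := sq_le_of_mem hα
  have ht := h.t_pos
  have hlt := h.lt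
  have hmid := h.mid
  have htop := h.top
  push_cast at hlt
  rcases lt_or_gt_of_ne h.y_ne with hy | hy
  · exact hy
  exfalso
  -- Here `t < α + 1`, so `x < -1/(α+1)`, which is left of the middle rectangle because `α² ≤ α +
  -- 1`, and left of the top one because `α² - α + 1 > 0`.
  rcases lt_or_gt_of_ne h.y_ne_one with hy1 | hy1
  · have := hmid hy hy1
    have hα1 : 0 < α - 1 := by by_contra hc; nlinarith
    nlinarith
  · have := htop hy1
    have hα1 : 0 < 1 - α := by by_contra hc; nlinarith
    nlinarith

theorem IsBranch.denom_pos {α s t y : ℝ} {k : ℕ} (hα : α ∈ Icc g G) (hs : s = 1 ∨ s = -1)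
    (h : IsBranch α s t k y) : 0 < (2 * k + 1) + s * y := by
  have hG1 := G_gt; have hG2 := G_lt
  have hy := h.y_pos
  have hyG := h.y_lt
  have hk0 : (0 : ℝ) ≤ k := k.cast_nonneg
  rcases hs with rfl | rfl
  · linarith
  rcases Nat.eq_zero_or_pos k with rfl | hk
  · have := h.lt_of_neg_zero hα
    push_cast; linarith
  · have hk1 : (1 : ℝ) ≤ k := by exact_mod_cast hk
    linarith

theorem mapsTo_branch {α s t : ℝ} {k : ℕ} {y : ℝ} (hα : α ∈ Icc g G) (hs : s = 1 ∨ s = -1)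
    (h : IsBranch α s t k y) :
    (t - (2 * k + 1), 1 / ((2 * k + 1) + s * y)) ∈ Omega α := by
  have hG1 := G_gt; have hG2 := G_lt; have hG := G_sq
  have h1 := gt_of_mem hα; have h2 := lt_of_mem hα; have h3 := sq_le_of_mem hα
  have h4 := one_le_of_mem hα
  have ht := h.t_pos
  have hlo := h.gt
  have hhi := h.lt
  have hy := h.y_pos
  have hyG := h.y_lt
  have hα2 : 0 < 2 - α := by linarith
  have hα0 : 0 < α := by linarith
  set D : ℝ := (2 * k + 1) + s * y with hD
  -- Since `(1+G)(2-G) = 1`, the value of `D` relative to `1+G` and `1` decides the strip of the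
  -- image. Digit `1` with `x < 0` lands in the top strip; digit `1` with `x > 0`, and digit `3`
  -- with `x < 0`, `y > 2-G`, in the middle one; everything else in the bottom one.
  have first : 1 + G < D → (t - (2 * k + 1), 1 / D) ∈ Omega α := by
    intro hDG
    have hD0 : 0 < D := by linarith
    refine Or.inl (Or.inl ⟨⟨hlo.le, hhi⟩, (one_div_pos.2 hD0).le, ?_⟩)
    change 1 / D < 2 - G
    rw [div_lt_iff₀ hD0]; nlinarith
  have second : 1 ≤ D → D < 1 + G → 1 - α < (t - (2 * k + 1)) * α →
      (t - (2 * k + 1), 1 / D) ∈ Omega α := by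
    intro hD1 hDG hx
    have hD0 : 0 < D := by linarith
    refine Or.inl (Or.inr ⟨⟨?_, hhi⟩, ?_, ?_⟩)
    · change (1 - α) / α < _
      rwa [div_lt_iff₀ hα0]
    · change 2 - G < 1 / D
      rw [lt_div_iff₀ hD0]; nlinarith
    · change 1 / D ≤ 1
      rw [div_le_iff₀ hD0]; linarith
  rcases Nat.eq_zero_or_pos k with rfl | hk
  · simp only [Nat.cast_zero, mul_zero, zero_add] at *
    rcases hs with rfl | rfl
    · exact second (by linarith) (by linarith) (by linarith [h.end_pos rfl])
    · have hy2 := h.lt_of_neg_zero hα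
      have hD0 : 0 < D := by linarith
      refine Or.inr ⟨⟨?_, hhi⟩, ?_, ?_⟩
      · change (α - 1) / (2 - α) ≤ _
        rw [div_le_iff₀ hα2]; linarith [h.end_neg rfl]
      · change 1 ≤ 1 / D
        rw [le_div_iff₀ hD0]; linarith
      · change 1 / D < G
        rw [div_lt_iff₀ hD0]; nlinarith
  have hk1 : (1 : ℝ) ≤ k := by exact_mod_cast hk
  rcases hs with rfl | rfl
  · exact first (by linarith)
  rcases Nat.eq_or_lt_of_le hk with rfl | hk
  · simp only [Nat.cast_one] at *
    rcases lt_or_gt_of_ne h.y_ne with hy2 | hy2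
    · exact first (by linarith)
    refine second (by linarith) (by linarith) ?_
    -- Staying right of `(1-α)/α` uses both bounds on `α`: failure would give `α² > α + 1` for `y <
    -- 1`, and `α² + α < 1` for `y > 1`.
    rcases lt_or_gt_of_ne h.y_ne_one with hy1 | hy1
    · have := h.mid hy2 hy1
      have hα1 : 0 < α - 1 := by by_contra hc; nlinarith
      by_contra! hc
      have hc' : (t - (2 * 1 + 1)) * α * (α - 1) ≤ (1 - α) * (α - 1) := by gcongr
      nlinarith
    · have := h.top hy1
      have hα1 : 0 < 1 - α := by by_contra hc; nlinarith
      by_contra! hc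
      have hc' : (t - (2 * 1 + 1)) * α * (1 - α) ≤ (1 - α) * (1 - α) := by gcongr
      nlinarith
  · have hk2 : (2 : ℝ) ≤ k := by exact_mod_cast hk
    exact first (by linarith)

/-- The weight making `Φ_α` contract the fibres. -/
def weight (y : ℝ) : ℝ := if y < 2 - G then 1 else if y < 1 then 4 / 5 else 3 / 5

theorem weight_mem (y : ℝ) : weight y ∈ Icc (3 / 5) 1 := by
  unfold weight; split_ifs <;> constructor <;> norm_num

/-- `|1/D - 1/D'| = |y-y'|/(DD')` for two points of a fibre, so a bound for each point separately
suffices. The tight cases fixing the constants are `3G/5 < 98/100` (image in the top strip) and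
`(3-G)·3/5 > 40/49` (digit `3`, `x < 0`, `y > 1`), where `40/49 = (4/5)/(98/100)`. -/
theorem weight_branch {α s t : ℝ} {k : ℕ} {y : ℝ} (hα : α ∈ Icc g G) (hs : s = 1 ∨ s = -1)
    (h : IsBranch α s t k y) :
    1 / ((2 * k + 1) + s * y) * weight (1 / ((2 * k + 1) + s * y)) ≤ 98 / 100 * weight y := by
  have hG1 := G_gt; have hG2 := G_lt; have hG := G_sq
  have hy := h.y_pos
  have hyG := h.y_lt
  set D : ℝ := (2 * k + 1) + s * y with hD
  have first : 1 + G < D → 1 / D * weight (1 / D) ≤ 98 / 100 * weight y := by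
    intro hDG
    have hD0 : 0 < D := by linarith
    have h2 : 1 / D < 2 - G := by rw [div_lt_iff₀ hD0]; nlinarith
    have h3 : 0 < 1 / D := one_div_pos.2 hD0
    have h4 := weight_mem y
    have h5 := weight_mem (1 / D)
    nlinarith [h4.1, h5.2, h5.1]
  have second : 1 < D → D < 1 + G → 40 / 49 ≤ D * weight y →
      1 / D * weight (1 / D) ≤ 98 / 100 * weight y := by
    intro hD1 hDG hDw
    have hD0 : 0 < D := by linarith
    have h2 : ¬ 1 / D < 2 - G := by
      rw [not_lt, le_div_iff₀ hD0]; nlinarith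
    have h3 : 1 / D < 1 := by rw [div_lt_iff₀ hD0]; linarith
    have h4 : weight (1 / D) = 4 / 5 := by rw [weight, if_neg h2, if_pos h3]
    rw [h4, div_mul_eq_mul_div, div_le_iff₀ hD0]
    linarith
  rcases Nat.eq_zero_or_pos k with rfl | hk
  · simp only [Nat.cast_zero, mul_zero, zero_add] at *
    rcases hs with rfl | rfl
    · refine second (by linarith) (by linarith) ?_
      unfold weight; split_ifs <;> linarith
    · have hy2 := h.lt_of_neg_zero hα
      have hD0 : 0 < D := by linarith
      have h2 : 1 ≤ 1 / D := by rw [le_div_iff₀ hD0]; linarith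
      have h3 : 1 / D ≤ G := by rw [div_le_iff₀ hD0]; nlinarith
      have h4 : weight (1 / D) = 3 / 5 := by
        rw [weight, if_neg (by linarith), if_neg (by linarith)]
      rw [h4, weight, if_pos hy2]
      linarith
  have hk1 : (1 : ℝ) ≤ k := by exact_mod_cast hk
  rcases hs with rfl | rfl
  · exact first (by linarith)
  rcases Nat.eq_or_lt_of_le hk with rfl | hk
  · simp only [Nat.cast_one] at *
    rcases lt_or_gt_of_ne h.y_ne with hy2 | hy2
    · exact first (by linarith)
    refine second (by linarith) (by linarith) ?_
    unfold weight; split_ifs <;> linarith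
  · have hk2 : (2 : ℝ) ≤ k := by exact_mod_cast hk
    exact first (by linarith)

/-- Equality would give `y₁ + y₂ = 2(k₂-k₁) < 4`, hence `k₂ = k₁ + 1`, `t₂ = t₁ + 2` and `y₁ + y₂ =
2`. So one point lies in the middle strip and the other in the top one, and the left ends of these
strips are matched so that their two conditions become opposite inequalities. -/
theorem branch_ne {α t₁ t₂ : ℝ} {k₁ k₂ : ℕ} {y₁ y₂ : ℝ}
    (h₁ : IsBranch α 1 t₁ k₁ y₁) (h₂ : IsBranch α (-1) t₂ k₂ y₂)
    (ht : t₁ - (2 * k₁ + 1) = t₂ - (2 * k₂ + 1)) :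
    (2 * k₁ + 1) + 1 * y₁ ≠ (2 * k₂ + 1) + -1 * y₂ := by
  intro hy
  have hG2 := G_lt
  have h1 := h₁.y_pos; have h2 := h₂.y_pos; have h3 := h₁.y_lt; have h4 := h₂.y_lt
  have hlo : (k₁ : ℝ) < k₂ := by linarith
  have hhi : (k₂ : ℝ) < k₁ + 2 := by linarith
  have hk : k₂ = k₁ + 1 := by
    have a : k₁ < k₂ := by exact_mod_cast hlo
    have b : k₂ < k₁ + 2 := by exact_mod_cast hhi
    omega
  subst hk
  push_cast at *
  obtain rfl : t₂ = t₁ + 2 := by linarith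
  rcases lt_or_gt_of_ne h₁.y_ne_one with hy1 | hy1
  · linarith [h₁.mid (by linarith) hy1, h₂.top (by linarith)]
  · linarith [h₁.top hy1, h₂.mid (by linarith) (by linarith)]

theorem branch_unique {α s₁ t₁ s₂ t₂ : ℝ} {k₁ k₂ : ℕ} {y₁ y₂ : ℝ}
    (hs₁ : s₁ = 1 ∨ s₁ = -1) (hs₂ : s₂ = 1 ∨ s₂ = -1)
    (h₁ : IsBranch α s₁ t₁ k₁ y₁) (h₂ : IsBranch α s₂ t₂ k₂ y₂)
    (ht : t₁ - (2 * k₁ + 1) = t₂ - (2 * k₂ + 1))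
    (hy : (2 * k₁ + 1) + s₁ * y₁ = (2 * k₂ + 1) + s₂ * y₂) :
    s₁ = s₂ ∧ k₁ = k₂ := by
  have hG2 := G_lt
  have h1 := h₁.y_pos; have h2 := h₂.y_pos; have h3 := h₁.y_lt; have h4 := h₂.y_lt
  have hs : s₁ = s₂ := by
    rcases hs₁ with rfl | rfl <;> rcases hs₂ with rfl | rfl
    · rfl
    · exact absurd hy (branch_ne h₁ h₂ ht)
    · exact absurd hy.symm (branch_ne h₂ h₁ ht.symm)
    · rfl
  subst hs
  refine ⟨rfl, ?_⟩
  -- With equal signs, `2|k₁-k₂| = |y₁-y₂| < G < 2`.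
  have hlo : (k₁ : ℝ) < k₂ + 1 := by rcases hs₁ with rfl | rfl <;> linarith
  have hhi : (k₂ : ℝ) < k₁ + 1 := by rcases hs₁ with rfl | rfl <;> linarith
  have a : k₁ < k₂ + 1 := by exact_mod_cast hlo
  have b : k₂ < k₁ + 1 := by exact_mod_cast hhi
  omega

/-! ### `Φ_α` on regular points -/

theorem measurable_d (α : ℝ) : Measurable (d α) := by
  unfold d
  have h : Measurable fun x : ℝ => 1 / (2 * |x|) + (1 - α) / 2 := by fun_prop
  have h2 : Measurable fun x : ℝ => (⌊1 / (2 * |x|) + (1 - α) / 2⌋ : ℝ) :=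
    (measurable_from_top (f := fun n : ℤ => (n : ℝ))).comp h.floor
  exact (h2.const_mul 2).add_const 1

theorem measurable_phi (α : ℝ) : Measurable (phi α) := by
  have := measurable_d α
  unfold phi
  exact Measurable.ite (measurableSet_singleton 0) measurable_const (by fun_prop)

theorem measurable_sign : Measurable Real.sign := by
  unfold Real.sign
  exact Measurable.ite measurableSet_Iio measurable_const
    (Measurable.ite measurableSet_Ioi measurable_const measurable_const)

theorem measurable_Phi (α : ℝ) : Measurable (Phi α) := by
  have h1 := measurable_d α
  have h2 := measurable_phi α
  have h3 := measurable_sign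
  unfold Phi
  fun_prop

theorem measurableSet_Omega (α : ℝ) : MeasurableSet (Omega α) :=
  ((measurableSet_Ico.prod measurableSet_Ico).union (measurableSet_Ioo.prod measurableSet_Ioc)).union
    (measurableSet_Ico.prod measurableSet_Ico)

theorem countable_excPoints (α : ℝ) : (excPoints α).Countable :=
  Countable.union (by simp) (countable_phi_eq α _)

theorem countable_excLines : excLines.Countable := by simp [excLines]

theorem measurableSet_regular (α : ℝ) : MeasurableSet (regular α) :=
  (measurableSet_Omega α).diff ((measurable_fst (countable_excPoints α).measurableSet).union
    (measurable_snd countable_excLines.measurableSet))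

theorem volume_excLines (α : ℝ) :
    volume (Prod.fst ⁻¹' excPoints α ∪ Prod.snd ⁻¹' excLines : Set (ℝ × ℝ)) = 0 := by
  refine measure_union_null ?_ ?_
  · rw [← prod_univ, Measure.volume_eq_prod, Measure.prod_prod,
      (countable_excPoints α).measure_zero, zero_mul]
  · rw [← univ_prod, Measure.volume_eq_prod, Measure.prod_prod, countable_excLines.measure_zero,
      mul_zero]

theorem Phi_of_branch {α : ℝ} {z : ℝ × ℝ} {s t : ℝ} {k : ℕ} (hsign : Real.sign z.1 = s)
    (hd : d α z.1 = 2 * k + 1) (hphi : phi α z.1 = t - (2 * k + 1)) :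
    Phi α z = (t - (2 * k + 1), 1 / ((2 * k + 1) + s * z.2)) := by
  rw [Phi, hphi, hd, hsign]

theorem Phi_mem_Omega {α : ℝ} (hα : α ∈ Icc g G) {z : ℝ × ℝ} (hz : z ∈ regular α) :
    Phi α z ∈ Omega α := by
  obtain ⟨s, t, k, hs, -, hsign, hd, hphi, hb⟩ := exists_branch hα hz
  rw [Phi_of_branch hsign hd hphi]
  exact mapsTo_branch hα hs hb

theorem injOn_Phi {α : ℝ} (hα : α ∈ Icc g G) : InjOn (Phi α) (regular α) := by
  intro z hz w hw h
  obtain ⟨s, t, k, hs, hx, hsign, hd, hphi, hb⟩ := exists_branch hα hz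
  obtain ⟨s', t', k', hs', hx', hsign', hd', hphi', hb'⟩ := exists_branch hα hw
  rw [Phi_of_branch hsign hd hphi, Phi_of_branch hsign' hd' hphi', Prod.mk.injEq,
    one_div, one_div, inv_inj] at h
  obtain ⟨rfl, rfl⟩ := branch_unique hs hs' hb hb' h.1 h.2
  obtain rfl : t = t' := by linarith [h.1]
  have hs0 : s ≠ 0 := by rcases hs with rfl | rfl <;> norm_num
  exact Prod.ext (hx.trans hx'.symm) (mul_left_cancel₀ hs0 (add_left_cancel h.2))

/-! ### Derivative of `Φ_α` and invariance of the density -/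

theorem det_prodMap_toSpanSingleton (a b : ℝ) :
    ((ContinuousLinearMap.toSpanSingleton ℝ a).prodMap
      (ContinuousLinearMap.toSpanSingleton ℝ b)).det = a * b := by
  have : ((ContinuousLinearMap.toSpanSingleton ℝ a).prodMap
      (ContinuousLinearMap.toSpanSingleton ℝ b)).toLinearMap =
      LinearMap.prodMap (ContinuousLinearMap.toSpanSingleton ℝ a).toLinearMap
        (ContinuousLinearMap.toSpanSingleton ℝ b).toLinearMap := rfl
  rw [ContinuousLinearMap.det, this, LinearMap.det_prodMap, ← ContinuousLinearMap.det,
    ← ContinuousLinearMap.det, ContinuousLinearMap.det_toSpanSingleton,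
    ContinuousLinearMap.det_toSpanSingleton]

open Filter Topology in
-- A value other than `α - 2` means that the argument of the floor is not an integer, so the floor
-- is locally constant.
theorem eventually_d_eq {α x : ℝ} (hx : x ≠ 0) (h : phi α x ∈ Ioo (α - 2) α) :
    ∀ᶠ x' in 𝓝 x, d α x' = d α x := by
  have hpos := abs_pos.2 hx
  set u : ℝ → ℝ := fun x => 1 / (2 * |x|) + (1 - α) / 2 with hu
  have hd : ∀ x, d α x = 2 * (⌊u x⌋ : ℝ) + 1 := fun x => rfl
  have hux : 1 / |x| = 2 * u x - 1 + α := by simp only [hu]; field_simp; ring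
  rw [phi, if_neg hx, hd, hux] at h
  have hcont : ContinuousAt u x := by
    have : 2 * |x| ≠ 0 := by positivity
    exact ContinuousAt.add (f := fun x => 1 / (2 * |x|))
      (continuousAt_const.div (by fun_prop) this) continuousAt_const
  have hmem : u x ∈ Ioo (⌊u x⌋ : ℝ) (⌊u x⌋ + 1) :=
    ⟨by linarith [h.1], by linarith [h.2]⟩
  filter_upwards [hcont.preimage_mem_nhds (Ioo_mem_nhds hmem.1 hmem.2)] with x' hx'
  have : ⌊u x'⌋ = ⌊u x⌋ := Int.floor_eq_iff.2 ⟨hx'.1.le, hx'.2⟩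
  rw [hd, hd, this]

open Filter Topology in
theorem eventually_sign_eq {x : ℝ} (hx : x ≠ 0) : ∀ᶠ x' in 𝓝 x, Real.sign x' = Real.sign x := by
  rcases lt_or_gt_of_ne hx with h | h
  · filter_upwards [Iio_mem_nhds h] with x' hx'
    rw [Real.sign_of_neg h, Real.sign_of_neg hx']
  · filter_upwards [Ioi_mem_nhds h] with x' hx'
    rw [Real.sign_of_pos h, Real.sign_of_pos hx']

open Filter Topology in
theorem hasFDerivAt_Phi {α : ℝ} (hα : α ∈ Icc g G) {z : ℝ × ℝ} (hz : z ∈ regular α) :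
    HasFDerivAt (Phi α) ((ContinuousLinearMap.toSpanSingleton ℝ (-Real.sign z.1 / z.1 ^ 2)).prodMap
      (ContinuousLinearMap.toSpanSingleton ℝ
        (-Real.sign z.1 / (d α z.1 + Real.sign z.1 * z.2) ^ 2))) z := by
  obtain ⟨s, t, k, hs, hx, hsign, hd, hphi, hb⟩ := exists_branch hα hz
  have hs0 : s ≠ 0 := by rcases hs with rfl | rfl <;> norm_num
  have hs2 : s * s = 1 := by rcases hs with rfl | rfl <;> norm_num
  have hx0 : z.1 ≠ 0 := by rw [hx]; exact div_ne_zero hs0 hb.t_pos.ne'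
  have hD := hb.denom_pos hα hs
  have hev1 := eventually_d_eq hx0 (by rw [hphi]; exact ⟨hb.gt, hb.lt⟩)
  have hev2 := eventually_sign_eq hx0
  rw [hsign, hd] at *
  have hev : Phi α =ᶠ[𝓝 z]
      Prod.map (fun x => s * x⁻¹ - (2 * k + 1)) (fun y => ((2 * k + 1) + s * y)⁻¹) := by
    have hev3 : ∀ᶠ x in 𝓝 z.1, x ≠ 0 := isOpen_ne.mem_nhds hx0
    filter_upwards [continuousAt_fst.eventually hev1, continuousAt_fst.eventually hev2,
      continuousAt_fst.eventually hev3] with w h1 h2 h3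
    have habs : |w.1| = s * w.1 := by
      rcases lt_or_gt_of_ne h3 with h | h
      · rw [← h2, abs_of_neg h, Real.sign_of_neg h]; ring
      · rw [← h2, abs_of_pos h, Real.sign_of_pos h]; ring
    have hsinv : s⁻¹ = s := inv_eq_of_mul_eq_one_right hs2
    rw [Phi, phi, if_neg h3, h1, h2, habs, one_div, one_div, mul_inv, hsinv]
    rfl
  refine HasFDerivAt.congr_of_eventuallyEq ?_ hev
  refine HasFDerivAt.prodMap z ?_ ?_
  · have h := ((hasDerivAt_inv hx0).const_mul s).sub_const (2 * (k : ℝ) + 1)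
    exact (h.congr_deriv (by ring)).hasFDerivAt
  · have h := (((hasDerivAt_id z.2).const_mul s).const_add (2 * (k : ℝ) + 1)).inv hD.ne'
    exact (h.congr_deriv (by simp)).hasFDerivAt

/-- The density of `μ_α`. -/
def density (z : ℝ × ℝ) : ENNReal := ENNReal.ofReal (1 / (1 + z.1 * z.2) ^ 2)

theorem measurable_density : Measurable density := by unfold density; fun_prop

theorem mu_apply (α : ℝ) {A : Set (ℝ × ℝ)} (hA : MeasurableSet A) (h : A ⊆ Omega α) :
    mu α A = ∫⁻ z in A, density z := by
  rw [mu, withDensity_apply _ hA, Measure.restrict_restrict hA, inter_eq_left.2 h]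
  rfl

/-- With `(x', y')` the image, `1+xy = (t+sy)/t`, `1+x'y' = (t+sy)/D`, and the Jacobian is `t²/D²`.
-/
theorem density_Phi {α : ℝ} (hα : α ∈ Icc g G) {z : ℝ × ℝ} (hz : z ∈ regular α) :
    ENNReal.ofReal |((ContinuousLinearMap.toSpanSingleton ℝ (-Real.sign z.1 / z.1 ^ 2)).prodMap
      (ContinuousLinearMap.toSpanSingleton ℝ
        (-Real.sign z.1 / (d α z.1 + Real.sign z.1 * z.2) ^ 2))).det| * density (Phi α z) =
      density z := by
  rw [det_prodMap_toSpanSingleton]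
  obtain ⟨s, t, k, hs, hx, hsign, hd, hphi, hb⟩ := exists_branch hα hz
  have hs2 : s * s = 1 := by rcases hs with rfl | rfl <;> norm_num
  have hD := hb.denom_pos hα hs
  have ht := hb.t_pos
  rw [Phi_of_branch hsign hd hphi, hsign, hd, hx, density, density, hx,
    ← ENNReal.ofReal_mul (abs_nonneg _)]
  simp only
  set D : ℝ := (2 * k + 1) + s * z.2 with hDdef
  have h1 : 1 + (t - (2 * k + 1)) * (1 / D) = (t + s * z.2) / D := by
    field_simp; rw [hDdef]; ring
  have h2 : 1 + s / t * z.2 = (t + s * z.2) / t := by field_simp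
  have h3 : -s / (s / t) ^ 2 * (-s / D ^ 2) = t ^ 2 / D ^ 2 := by
    have : s ^ 2 = 1 := by rw [sq, hs2]
    rw [div_pow, this]; field_simp; rw [this]
  rw [h1, h2, h3, abs_of_nonneg (by positivity), div_pow, div_pow, one_div_div, one_div_div]
  congr 1
  field_simp

theorem mu_image {α : ℝ} (hα : α ∈ Icc g G) {B : Set (ℝ × ℝ)} (hB : MeasurableSet B)
    (hBr : B ⊆ regular α) : mu α (Phi α '' B) = mu α B := by
  have hinj := (injOn_Phi hα).mono hBr
  rw [mu_apply α (hB.image_of_measurable_injOn (measurable_Phi α) hinj)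
      (image_subset_iff.2 fun z hz => Phi_mem_Omega hα (hBr hz)),
    mu_apply α hB fun z hz => (hBr hz).1,
    lintegral_image_eq_lintegral_abs_det_fderiv_mul volume hB
      (fun z hz => (hasFDerivAt_Phi hα (hBr hz)).hasFDerivWithinAt) hinj]
  exact setLIntegral_congr_fun hB fun z hz => density_Phi hα (hBr hz)

theorem mu_compl_Omega (α : ℝ) : mu α (Omega α)ᶜ = 0 := by
  refine withDensity_absolutelyContinuous _ _ ?_
  rw [Measure.restrict_apply (measurableSet_Omega α).compl, compl_inter_self, measure_empty]

theorem mu_compl_regular (α : ℝ) : mu α (regular α)ᶜ = 0 := by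
  have h : mu α (Prod.fst ⁻¹' excPoints α ∪ Prod.snd ⁻¹' excLines) = 0 :=
    withDensity_absolutelyContinuous _ _
      (Measure.absolutelyContinuous_of_le Measure.restrict_le_self (volume_excLines α))
  refine measure_mono_null ?_ (measure_union_null (mu_compl_Omega α) h)
  rw [regular, compl_sdiff, union_comm]

/-! ### The total mass -/

theorem lintegral_Ioc_of_hasDerivAt {a b : ℝ} (hab : a ≤ b) {F f : ℝ → ℝ}
    (hF : ∀ x ∈ Icc a b, HasDerivAt F (f x) x) (hf : ContinuousOn f (Icc a b))
    (hf0 : ∀ x ∈ Icc a b, 0 ≤ f x) :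
    ∫⁻ x in Ioc a b, ENNReal.ofReal (f x) = ENNReal.ofReal (F b - F a) := by
  have hint : IntervalIntegrable f volume a b := by
    rw [← uIcc_of_le hab] at hf
    exact hf.intervalIntegrable
  rw [← intervalIntegral.integral_eq_sub_of_hasDerivAt (by rwa [uIcc_of_le hab]) hint,
    intervalIntegral.integral_of_le hab, ofReal_integral_eq_lintegral_ofReal hint.1]
  exact (ae_restrict_iff' measurableSet_Ioc).2 (ae_of_all _ fun x hx => hf0 x (Ioc_subset_Icc_self hx))

/-- `∂ₓ∂ᵧ log(1+xy) = (1+xy)⁻²`. As `y ≥ 0`, positivity of `1+xy` at the corner `(a, d)` gives it on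
the whole rectangle. -/
theorem lintegral_density_rect {a b c d : ℝ} (hab : a ≤ b) (hc : 0 ≤ c) (hcd : c ≤ d)
    (had : 0 < 1 + a * d) :
    ∫⁻ z in Ioc a b ×ˢ Ioc c d, density z =
      ENNReal.ofReal (Real.log (1 + b * d) - Real.log (1 + b * c) -
        (Real.log (1 + a * d) - Real.log (1 + a * c))) := by
  have hpos : ∀ x ∈ Icc a b, ∀ y ∈ Icc c d, 0 < 1 + x * y := by
    intro x hx y hy
    rcases le_or_gt 0 x with h | h
    · have := mul_nonneg h (hc.trans hy.1); linarith
    · nlinarith [hx.1, hy.2, hy.1]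
  rw [Measure.volume_eq_prod, setLIntegral_prod _ measurable_density.aemeasurable]
  have hinner : ∀ x ∈ Ioc a b, ∫⁻ y in Ioc c d, density (x, y) =
      ENNReal.ofReal (d / (1 + x * d) - c / (1 + x * c)) := by
    intro x hx
    have hx := Ioc_subset_Icc_self hx
    refine lintegral_Ioc_of_hasDerivAt hcd (F := fun y => y / (1 + x * y))
      (f := fun y => 1 / (1 + x * y) ^ 2) ?_ ?_ ?_
    · intro y hy
      have h := (hasDerivAt_id y).div (((hasDerivAt_id y).const_mul x).const_add 1)
        (hpos x hx y hy).ne'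
      exact h.congr_deriv (by simp [mul_comm])
    · exact continuousOn_const.div (by fun_prop) fun y hy => (pow_pos (hpos x hx y hy) 2).ne'
    · exact fun y _ => by positivity
  rw [setLIntegral_congr_fun measurableSet_Ioc hinner]
  refine lintegral_Ioc_of_hasDerivAt hab
    (F := fun x => Real.log (1 + x * d) - Real.log (1 + x * c)) ?_ ?_ ?_
  · intro x hx
    have h : ∀ e ∈ Icc c d, HasDerivAt (fun x => Real.log (1 + x * e)) (e / (1 + x * e)) x := by
      intro e he
      have := ((((hasDerivAt_id x).mul_const e).const_add 1).log (hpos x hx e he).ne')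
      simpa using this
    exact (h d (right_mem_Icc.2 hcd)).sub (h c (left_mem_Icc.2 hcd))
  · refine (continuousOn_const.div (by fun_prop) fun x hx => ?_).sub
      (continuousOn_const.div (by fun_prop) fun x hx => ?_)
    · exact (hpos x hx d (right_mem_Icc.2 hcd)).ne'
    · exact (hpos x hx c (left_mem_Icc.2 hcd)).ne'
  · intro x hx
    rw [sub_nonneg, div_le_div_iff₀ (hpos x hx c (left_mem_Icc.2 hcd))
      (hpos x hx d (right_mem_Icc.2 hcd))]
    nlinarith

theorem log_rect_nonneg {a b c d : ℝ} (hab : a ≤ b) (hc : 0 ≤ c) (hcd : c ≤ d)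
    (had : 0 < 1 + a * d) :
    0 ≤ Real.log (1 + b * d) - Real.log (1 + b * c) -
        (Real.log (1 + a * d) - Real.log (1 + a * c)) := by
  have hd := hc.trans hcd
  have hac : 0 < 1 + a * c := by
    rcases le_or_gt 0 a with h | h
    · positivity
    · nlinarith
  have hbc : 0 < 1 + b * c := by nlinarith
  have hbd : 0 < 1 + b * d := by nlinarith
  -- The two products differ by `(b-a)(d-c)`.
  have h := Real.log_le_log (mul_pos hbc had) (y := (1 + b * d) * (1 + a * c))
    (by nlinarith [mul_nonneg (sub_nonneg.2 hab) (sub_nonneg.2 hcd)])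
  rw [Real.log_mul hbc.ne' had.ne', Real.log_mul hbd.ne' hac.ne'] at h
  linarith

theorem Omega_ae_eq (α : ℝ) : Omega α =ᵐ[volume]
    (Ioc (α - 2) α ×ˢ Ioc 0 (2 - G) ∪ Ioc ((1 - α) / α) α ×ˢ Ioc (2 - G) 1 ∪
      Ioc ((α - 1) / (2 - α)) α ×ˢ Ioc 1 G : Set (ℝ × ℝ)) := by
  rw [Measure.volume_eq_prod]
  exact ((Measure.set_prod_ae_eq Ico_ae_eq_Ioc Ico_ae_eq_Ioc).union
    (Measure.set_prod_ae_eq Ioo_ae_eq_Ioc Filter.EventuallyEq.rfl)).union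
    (Measure.set_prod_ae_eq Ico_ae_eq_Ioc Ico_ae_eq_Ioc)

theorem mu_univ {α : ℝ} (hα : α ∈ Icc g G) : mu α univ = ENNReal.ofReal (3 * Real.log G) := by
  have hG1 := G_gt; have hG2 := G_lt; have hG := G_sq
  have h1 := gt_of_mem hα; have h2 := lt_of_mem hα; have h3 := sq_le_of_mem hα
  have h4 := one_le_of_mem hα
  have hα0 : 0 < α := by linarith
  have hα2 : 0 < 2 - α := by linarith
  have hq : 0 < α + G - 1 := by linarith
  have e1 : 1 + (α - 2) * (2 - G) = (2 - G) * (α + G - 1) := by linear_combination hG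
  have e2 : 1 + (1 - α) / α * 1 = 1 / α := by field_simp; ring
  have e3 : 1 + (1 - α) / α * (2 - G) = (G - 1) * (α + G - 1) / α := by
    field_simp; linear_combination -hG
  have e4 : 1 + α * G = G * (α + G - 1) := by linear_combination -hG
  have e5 : 1 + (α - 1) / (2 - α) * 1 = 1 / (2 - α) := by field_simp; ring
  have e6 : 1 + (α - 1) / (2 - α) * G = (G - 1) * (α + G - 1) / (2 - α) := by
    field_simp; linear_combination -hG
  have e7 : G - 1 = G⁻¹ := eq_inv_of_mul_eq_one_left (by linear_combination hG)
  have e8 : 2 - G = G⁻¹ ^ 2 := by rw [← e7]; linear_combination -hG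
  have p1 : 0 < 1 + (α - 2) * (2 - G) := by rw [e1]; exact mul_pos (by linarith) hq
  have p2 : 0 < 1 + (1 - α) / α * 1 := by rw [e2]; positivity
  have p3 : 0 < 1 + (α - 1) / (2 - α) * G := by
    rw [e6]; exact div_pos (mul_pos (by linarith) hq) hα2
  have l1 : α - 2 ≤ α := by linarith
  have l2 : (1 - α) / α ≤ α := by rw [div_le_iff₀ hα0]; linarith
  have l3 : (α - 1) / (2 - α) ≤ α := by rw [div_le_iff₀ hα2]; linarith
  have hm : ∀ a b c d : ℝ, MeasurableSet (Ioc a b ×ˢ Ioc c d : Set (ℝ × ℝ)) := fun a b c d =>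
    measurableSet_Ioc.prod measurableSet_Ioc
  have key : mu α univ = ∫⁻ z in Omega α, density z := by
    rw [mu, withDensity_apply _ MeasurableSet.univ, Measure.restrict_univ]
    rfl
  rw [key, setLIntegral_congr (Omega_ae_eq α), lintegral_union (hm _ _ _ _),
    lintegral_union (hm _ _ _ _), lintegral_density_rect l1 le_rfl (by linarith) p1,
    lintegral_density_rect l2 (by linarith) (by linarith) p2,
    lintegral_density_rect l3 (by linarith) (by linarith) p3,
    ← ENNReal.ofReal_add (log_rect_nonneg l1 le_rfl (by linarith) p1)
      (log_rect_nonneg l2 (by linarith) (by linarith) p2),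
    ← ENNReal.ofReal_add (add_nonneg (log_rect_nonneg l1 le_rfl (by linarith) p1)
      (log_rect_nonneg l2 (by linarith) (by linarith) p2))
      (log_rect_nonneg l3 (by linarith) (by linarith) p3)]
  · congr 1
    have hp : 0 < 2 - G := by linarith
    have hG0 : 0 < G := by linarith
    have hG' : 0 < G - 1 := by linarith
    -- The logarithms on the common right edge `x = α` telescope in `y`; the remaining corners
    -- involve only powers of `G`, the factor `α+G-1` and the denominators `α`, `2-α`, and all
    -- dependence on `α` cancels.
    rw [e1, e2, e3, e4, e5, e6, Real.log_mul hp.ne' hq.ne', Real.log_mul hG0.ne' hq.ne',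
      Real.log_div (mul_pos hG' hq).ne' hα0.ne', Real.log_div (mul_pos hG' hq).ne' hα2.ne',
      Real.log_mul hG'.ne' hq.ne', e7, e8, Real.log_pow, Real.log_inv, one_div, one_div,
      Real.log_inv, Real.log_inv]
    simp
    ring
  · exact disjoint_left.2 fun z hz hz' => absurd hz.2.2 (not_le.2 hz'.2.1)
  · refine disjoint_left.2 fun z hz hz' => ?_
    have h := hz'.2.1
    rcases hz with hz | hz
    · have := hz.2.2; linarith
    · exact absurd hz.2.2 (not_le.2 h)

theorem isProbabilityMeasure_muTilde {α : ℝ} (hα : α ∈ Icc g G) :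
    IsProbabilityMeasure (muTilde α) := by
  have hlog : 0 < 3 * Real.log G := mul_pos three_pos (Real.log_pos (by linarith [G_gt]))
  refine ⟨?_⟩
  rw [muTilde, Measure.smul_apply, mu_univ hα, smul_eq_mul,
    ← ENNReal.ofReal_mul (one_div_pos.2 hlog).le, one_div, inv_mul_cancel₀ hlog.ne',
    ENNReal.ofReal_one]

theorem muTilde_eq_zero {α : ℝ} {A : Set (ℝ × ℝ)} (h : mu α A = 0) : muTilde α A = 0 := by
  rw [muTilde, Measure.smul_apply, h, smul_zero]

theorem measurePreserving_Phi {α : ℝ} (hα : α ∈ Icc g G) :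
    MeasurePreserving (Phi α) (muTilde α) (muTilde α) := by
  have := isProbabilityMeasure_muTilde hα
  refine measurePreserving_of_measure_image (measurable_Phi α) (measurableSet_regular α)
    (muTilde_eq_zero (mu_compl_regular α)) fun B hB hBm => ?_
  simp only [muTilde, Measure.smul_apply, mu_image hα hBm hB]

/-! ### Contraction of the fibres -/

/-- A distance on the fibres which `Φ_α` contracts uniformly. -/
def gap (y y' : ℝ) : ℝ := |y - y'| * weight y * weight y'

theorem gap_Phi_le {α : ℝ} (hα : α ∈ Icc g G) {z w : ℝ × ℝ} (hz : z ∈ regular α)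
    (hw : w ∈ regular α) (h : z.1 = w.1) :
    gap (Phi α z).2 (Phi α w).2 ≤ (98 / 100) ^ 2 * gap z.2 w.2 := by
  obtain ⟨s, t, k, hs, hx, hsign, hd, hphi, hb⟩ := exists_branch hα hz
  obtain ⟨s', t', k', hs', hx', hsign', hd', hphi', hb'⟩ := exists_branch hα hw
  rw [Phi_of_branch hsign hd hphi, Phi_of_branch hsign' hd' hphi']
  rw [← h] at hsign' hd'
  -- Points of one fibre share sign and digit, so a single branch acts on both.
  obtain rfl : s = s' := hsign.symm.trans hsign'
  obtain rfl : k = k' := by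
    have : (k : ℝ) = k' := by linarith
    exact_mod_cast this
  have hD := hb.denom_pos hα hs
  have hD' := hb'.denom_pos hα hs
  have hw1 := weight_branch hα hs hb
  have hw2 := weight_branch hα hs hb'
  simp only [gap]
  set D : ℝ := (2 * k + 1) + s * z.2 with hDdef
  set D' : ℝ := (2 * k + 1) + s * w.2 with hDdef'
  have habs : |1 / D - 1 / D'| = |z.2 - w.2| * (1 / D) * (1 / D') := by
    have h1 : 1 / D - 1 / D' = -s * (z.2 - w.2) * ((1 / D) * (1 / D')) := by
      field_simp; rw [hDdef, hDdef']; ring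
    have h2 : |-s| = 1 := by rcases hs with rfl | rfl <;> simp
    rw [h1, abs_mul, abs_mul, h2, abs_of_pos (by positivity : 0 < 1 / D * (1 / D'))]
    ring
  have h0 : ∀ y, 0 ≤ weight y := fun y => by linarith [(weight_mem y).1]
  calc |1 / D - 1 / D'| * weight (1 / D) * weight (1 / D')
      = |z.2 - w.2| * ((1 / D * weight (1 / D)) * (1 / D' * weight (1 / D'))) := by
        rw [habs]; ring
    _ ≤ |z.2 - w.2| * ((98 / 100 * weight z.2) * (98 / 100 * weight w.2)) := by
        refine mul_le_mul_of_nonneg_left (mul_le_mul hw1 hw2 ?_ ?_) (abs_nonneg _)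
        · exact mul_nonneg (one_div_pos.2 hD').le (h0 _)
        · exact mul_nonneg (by norm_num) (h0 _)
    _ = (98 / 100) ^ 2 * (|z.2 - w.2| * weight z.2 * weight w.2) := by ring

theorem gap_le {α : ℝ} (hα : α ∈ Icc g G) {z w : ℝ × ℝ} (hz : z ∈ regular α)
    (hw : w ∈ regular α) : gap z.2 w.2 ≤ G := by
  obtain ⟨_, _, _, -, -, -, -, -, hb⟩ := exists_branch hα hz
  obtain ⟨_, _, _, -, -, -, -, -, hb'⟩ := exists_branch hα hw
  have h1 : |z.2 - w.2| ≤ G := by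
    rw [abs_le]
    constructor <;> linarith [hb.y_pos, hb.y_lt, hb'.y_pos, hb'.y_lt]
  have h2 := weight_mem z.2
  have h3 := weight_mem w.2
  have h4 := abs_nonneg (z.2 - w.2)
  have h5 : 0 ≤ weight z.2 := by linarith [h2.1]
  have h6 : 0 ≤ weight w.2 := by linarith [h3.1]
  calc gap z.2 w.2 ≤ |z.2 - w.2| * 1 * 1 := by
        unfold gap; gcongr
        · exact h2.2
        · exact h3.2
    _ ≤ G := by linarith

/-- Two backward `Φ_α`-orbits of regular points with the same base points coincide. -/
theorem eq_of_backward_orbits {α : ℝ} (hα : α ∈ Icc g G) {z w : ℕ → ℝ × ℝ}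
    (hz : ∀ n, z n ∈ regular α) (hw : ∀ n, w n ∈ regular α)
    (hzs : ∀ n, Phi α (z (n + 1)) = z n) (hws : ∀ n, Phi α (w (n + 1)) = w n)
    (h : ∀ n, (z n).1 = (w n).1) : z 0 = w 0 := by
  -- Index `n` is time `-n`: the present gap is an `n`-fold contraction of a gap bounded by `G`.
  have hstep : ∀ n, gap (z 0).2 (w 0).2 ≤ ((98 / 100) ^ 2) ^ n * gap (z n).2 (w n).2 := by
    intro n
    induction n with
    | zero => simp
    | succ n ih =>
      have := gap_Phi_le hα (hz (n + 1)) (hw (n + 1)) (h (n + 1))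
      rw [hzs, hws] at this
      refine ih.trans ?_
      rw [pow_succ _ n, mul_assoc]
      gcongr
  have hle : ∀ n, gap (z 0).2 (w 0).2 ≤ ((98 / 100) ^ 2) ^ n * G := fun n =>
    (hstep n).trans (mul_le_mul_of_nonneg_left (gap_le hα (hz n) (hw n)) (by positivity))
  have hlim : Filter.Tendsto (fun n : ℕ => ((98 / 100 : ℝ) ^ 2) ^ n * G) Filter.atTop (nhds 0) := by
    simpa using (tendsto_pow_atTop_nhds_zero_of_lt_one (r := (98 / 100 : ℝ) ^ 2)
      (by norm_num) (by norm_num)).mul_const G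
  have h0 : gap (z 0).2 (w 0).2 ≤ 0 := ge_of_tendsto' hlim hle
  have hpos : 0 < weight (z 0).2 * weight (w 0).2 :=
    mul_pos (by linarith [(weight_mem (z 0).2).1]) (by linarith [(weight_mem (w 0).2).1])
  rw [gap, mul_assoc] at h0
  have habs : |(z 0).2 - (w 0).2| ≤ 0 := nonpos_of_mul_nonpos_left h0 hpos
  exact Prod.ext (h 0) (sub_eq_zero.1 (abs_nonpos_iff.1 habs))

/-! ### The natural extension -/

theorem isExtension {α : ℝ} (hα : α ∈ Icc g G) :
    IsExtension (Omega α) (muTilde α) (Phi α) (I α) (nu α) (phi α) Prod.fst := by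
  have hprob := isProbabilityMeasure_muTilde hα
  have hfst : MeasurePreserving Prod.fst (muTilde α) (nu α) := ⟨measurable_fst, rfl⟩
  have hΦ := measurePreserving_Phi hα
  have hreg : ∀ᵐ z ∂muTilde α, z ∈ regular α := muTilde_eq_zero (mu_compl_regular α)
  have hphi : MeasurePreserving (phi α) (nu α) (nu α) := by
    refine ⟨measurable_phi α, ?_⟩
    -- The semiconjugacy holds everywhere by definition, so invariance of `nu α` is inherited from
    -- `muTilde α`.
    have h : phi α ∘ Prod.fst = Prod.fst ∘ Phi α := rfl
    rw [nu, Measure.map_map (measurable_phi α) measurable_fst, h,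
      ← Measure.map_map measurable_fst (measurable_Phi α), hΦ.map_eq]
  refine ⟨⟨measurableSet_Omega α, hprob, muTilde_eq_zero (mu_compl_Omega α),
    hreg.mono fun z hz => Phi_mem_Omega hα hz, hΦ⟩, ⟨measurableSet_Ico,
    Measure.isProbabilityMeasure_map measurable_fst.aemeasurable, ?_,
    ae_of_all _ (phi_mem_I hα), hphi⟩, fun z hz => Omega_subset_I hα hz, hfst,
    ae_of_all _ fun z => rfl⟩
  have hI : MeasurableSet (I α) := measurableSet_Ico
  rw [nu, Measure.map_apply measurable_fst hI.compl]
  have hsub : Prod.fst ⁻¹' (I α)ᶜ ⊆ (Omega α)ᶜ := fun z hz hz' => hz (Omega_subset_I hα hz')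
  exact measure_mono_null hsub (muTilde_eq_zero (mu_compl_Omega α))

end OddCF

end

theorem theorem14 (α : ℝ) (hα : α ∈ Set.Icc OddCF.g OddCF.G) :
    OddCF.IsNaturalExtension
      (OddCF.Omega α) (OddCF.muTilde α) (OddCF.Phi α)
      (OddCF.I α) (OddCF.nu α) (OddCF.phi α)
      Prod.fst := by
  refine ⟨OddCF.isExtension hα, ?_⟩
  have hprob := OddCF.isProbabilityMeasure_muTilde hα
  obtain ⟨S, hS, hSm, hSμ, e, he⟩ := OddCF.exists_measurableEquiv_of_injOn
    (OddCF.measurePreserving_Phi hα) (OddCF.measurableSet_regular α)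
    (OddCF.muTilde_eq_zero (OddCF.mu_compl_regular α)) (OddCF.injOn_Phi hα)
  have : StandardBorelSpace S := hSm.standardBorel
  refine ⟨S, fun z hz => (hS hz).1, hSm, measure_mono_null (fun z hz => hz.2) hSμ, e, he, ?_⟩
  refine OddCF.joinForward_eq_of_injective e (measurable_fst.comp measurable_subtype_coe) ?_
  intro z w h
  -- The iterates of `e.symm` form a backward `Φ_α`-orbit inside `S ⊆ regular α`, as
  -- `eq_of_backward_orbits` requires.
  have hback : ∀ (z : S) (n : ℕ),
      OddCF.Phi α (e.symm^[n + 1] z : S) = (e.symm^[n] z : S) := fun z n => by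
    rw [← he, Function.iterate_succ_apply', e.apply_symm_apply]
  exact Subtype.ext (OddCF.eq_of_backward_orbits hα
    (z := fun n => (e.symm^[n] z : S)) (w := fun n => (e.symm^[n] w : S))
    (fun n => hS (Subtype.prop _)) (fun n => hS (Subtype.prop _)) (hback z) (hback w)
    (fun n => congrFun h n))
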